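/- Let $\mathcal G:\ x'=Ax+bu,\ y=cx+du$ with $A\in\mathbb R^{n\times n}$, $b\in\mathbb R^{n\times 1}$, $c\in\mathbb R^{1\times n}$, $d\in\mathbb R$ be an asymptotically stable (all eigenvalues of $A$ have negative real part), minimal (reachable and observable) SISO system that is balanced, i.e. its reachability and observability Gramians, the positive definite solutions $\mathcal P,\mathcal Q$ of $$A\mathcal P+\mathcal PA^{\top}+bb^{\top}=0,\qquad A^{\top}\mathcal Q+\mathcal QA+c^{\top}c=0,$$ satisfy $$\mathcal P=\mathcal Q=\Sigma=\mathrm{diag}(\sigma_1I_{m_1},\dots,\sigma_qI_{m_q}),\qquad \sigma_1>\dots>\sigma_q>0,\quad m_j\ge 1,\quad m_1+\dots+m_q=n.$$ Let $s_1,\dots,s_n\in\{\pm1\}$ be sign parameters of $\mathcal G$: with $S=\mathrm{diag}(s_1,\dots,s_n)$, some realization $(\bar A,\bar b,\bar c,d)$ of $\mathcal G$, obtained by a change of state coordinates, is balanced with Gramian $\Sigma$ and satisfies $\bar A=S\bar A^{\top}S$ and $\bar b=(\bar cS)^{\top}$. Let $1\le k<q$ and $r=m_1+\dots+m_k$, and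 partition conformally $$A=\begin{bmatrix}A_{11}&A_{12}\\A_{21}&A_{22}\end{bmatrix},\quad b=\begin{bmatrix}b_1\\b_2\end{bmatrix},\quad c=\begin{bmatrix}c_1&c_2\end{bmatrix},\quad S=\mathrm{diag}(S_1,S_2),$$ where $A_{11}$ and $S_1$ are $r\times r$. Suppose that all signs in $S_2$ are the same, i.e. $S_2=I_{n-r}$ or $S_2=-I_{n-r}$. Then $A_{22}$ is invertible, so that the order-$r$ singular perturbation balancing approximation $\mathcal G_r^{\rm sp}$ of $\mathcal G$, with $$A_r^{\rm sp}=A_{11}-A_{12}A_{22}^{-1}A_{21},\quad b_r^{\rm sp}=b_1-A_{12}A_{22}^{-1}b_2,\quad c_r^{\rm sp}=c_1-c_2A_{22}^{-1}A_{21},\quad d_r^{\rm sp}=d-c_2A_{22}^{-1}b_2,$$ is well defined; it is asymptotically stable; and $$\big\|\mathcal G-\mathcal G_r^{\rm sp}\big\|_{\mathcal H_\infty}=\sup_{\omega\in\mathbb R}\big|G(\mathrm i\omega)-G_r^{\rm sp}(\mathrm i\omega)\big|=2(\sigma_{k+1}+\dots+\sigma_q),$$ where $G(s)=c(sI-A)^{-1}b+d$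 and $G_r^{\rm sp}(s)=c_r^{\rm sp}(sI-A_r^{\rm sp})^{-1}b_r^{\rm sp}+d_r^{\rm sp}$ are the transfer functions. -/

import Mathlib

open scoped ENNReal Matrix

/-- A real single-input single-output linear time-invariant system
`x' = A x + b u`, `y = c x + d u`, whose state coordinates are indexed by `ι`
(the order of the system is the cardinality of `ι`). The column `b` and the row `c` are
stored as vectors. -/
structure SISOSystem (ι : Type*) where
  A : Matrix ι ι ℝ
  b : ι → ℝ
  c : ι → ℝ
  d : ℝ

namespace SISOSystem

variable {ι : Type*} [Fintype ι] [DecidableEq ι]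

/-- The transfer function `G(s) = c (s I - A)⁻¹ b + d`. -/
noncomputable def transferFunction (G : SISOSystem ι) (s : ℂ) : ℂ :=
  (fun i => (G.c i : ℂ)) ⬝ᵥ
    ((s • (1 : Matrix ι ι ℂ) - G.A.map Complex.ofReal)⁻¹ *ᵥ fun i => (G.b i : ℂ)) + (G.d : ℂ)

/-- Asymptotic stability: all (complex) eigenvalues of `A` have negative real part. -/
def AsymptoticallyStable (G : SISOSystem ι) : Prop :=
  ∀ z ∈ spectrum ℂ (G.A.map Complex.ofReal), z.re < 0

/-- Reachability: `b, A b, A² b, …` span the state space. -/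
def Reachable (G : SISOSystem ι) : Prop :=
  Submodule.span ℝ (Set.range fun j : ℕ => (G.A ^ j) *ᵥ G.b) = ⊤

/-- Observability: a state `x` with `c Aʲ x = 0` for all `j` is zero. -/
def Observable (G : SISOSystem ι) : Prop :=
  ∀ x : ι → ℝ, (∀ j : ℕ, G.c ⬝ᵥ ((G.A ^ j) *ᵥ x) = 0) → x = 0

/-- Minimality of a state-space system: reachable and observable. -/
def Minimal (G : SISOSystem ι) : Prop := G.Reachable ∧ G.Observable

/-- `P` is a positive definite solution of `A P + P Aᵀ + b bᵀ = 0`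
(unique when the system is asymptotically stable). -/
def IsReachabilityGramian (G : SISOSystem ι) (P : Matrix ι ι ℝ) : Prop :=
  P.PosDef ∧ G.A * P + P * G.Aᵀ + Matrix.vecMulVec G.b G.b = 0

/-- `Q` is a positive definite solution of `Aᵀ Q + Q A + cᵀ c = 0`
(unique when the system is asymptotically stable). -/
def IsObservabilityGramian (G : SISOSystem ι) (Q : Matrix ι ι ℝ) : Prop :=
  Q.PosDef ∧ G.Aᵀ * Q + Q * G.A + Matrix.vecMulVec G.c G.c = 0

/-- (Principal-axis) balanced: both Gramians equal the diagonal matrix with diagonal `h`. -/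
def IsBalanced (G : SISOSystem ι) (h : ι → ℝ) : Prop :=
  G.IsReachabilityGramian (Matrix.diagonal h) ∧ G.IsObservabilityGramian (Matrix.diagonal h)

/-- The realization of the same system in the state coordinates `x̃` given by `x = T x̃`. -/
noncomputable def changeCoordinates (G : SISOSystem ι) (T : Matrix ι ι ℝ) : SISOSystem ι where
  A := T⁻¹ * G.A * T
  b := T⁻¹ *ᵥ G.b
  c := G.c ᵥ* T
  d := G.d

/-- The sign symmetry `A = S Aᵀ S`, `b = (c S)ᵀ` with `S = diag(s)`. -/
def IsSignSymmetric (G : SISOSystem ι) (s : ι → ℝ) : Prop :=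
  G.A = Matrix.diagonal s * G.Aᵀ * Matrix.diagonal s ∧ G.b = G.c ᵥ* Matrix.diagonal s

/-- `s` is a vector of sign parameters of `G`, each sign `s i` being associated with the Hankel
singular value `h i`: some realization of `G` (obtained by a change of state coordinates) is
balanced with Gramian `diag(h)` and sign symmetric with respect to `S = diag(s)`. The system `G`
itself need not be sign symmetric. -/
def IsSignParameters (G : SISOSystem ι) (h s : ι → ℝ) : Prop :=
  (∀ i, s i = 1 ∨ s i = -1) ∧
    ∃ T : Matrix ι ι ℝ, IsUnit T ∧
      (G.changeCoordinates T).IsBalanced h ∧ (G.changeCoordinates T).IsSignSymmetric s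

/-- The block `A₂₂` of `A` belonging to the discarded coordinates, when the coordinates satisfying
`p` are retained. -/
def discardedBlock (G : SISOSystem ι) (p : ι → Prop) :
    Matrix {i // ¬ p i} {i // ¬ p i} ℝ :=
  G.A.toBlock (fun i => ¬ p i) (fun i => ¬ p i)

/-- The singular perturbation approximation retaining the coordinates that satisfy `p`, obtained
by setting `x₂' = 0` for the others:
`A₁₁ - A₁₂ A₂₂⁻¹ A₂₁`, `b₁ - A₁₂ A₂₂⁻¹ b₂`, `c₁ - c₂ A₂₂⁻¹ A₂₁`, `d - c₂ A₂₂⁻¹ b₂`. -/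
noncomputable def singularPerturbation (G : SISOSystem ι) (p : ι → Prop) [DecidablePred p] :
    SISOSystem {i // p i} :=
  let A₁₁ := G.A.toBlock p p
  let A₁₂ := G.A.toBlock p (fun i => ¬ p i)
  let A₂₁ := G.A.toBlock (fun i => ¬ p i) p
  let A₂₂ := G.discardedBlock p
  let b₁ : {i // p i} → ℝ := fun i => G.b i
  let b₂ : {i // ¬ p i} → ℝ := fun i => G.b i
  let c₁ : {i // p i} → ℝ := fun i => G.c i
  let c₂ : {i // ¬ p i} → ℝ := fun i => G.c i
  { A := A₁₁ - A₁₂ * A₂₂⁻¹ * A₂₁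
    b := b₁ - (A₁₂ * A₂₂⁻¹) *ᵥ b₂
    c := c₁ - c₂ ᵥ* (A₂₂⁻¹ * A₂₁)
    d := G.d - c₂ ⬝ᵥ (A₂₂⁻¹ *ᵥ b₂) }

end SISOSystem

/-- The `H∞` norm `sup_{ω ∈ ℝ} |F(i ω)|` of a transfer function, as an extended nonnegative
real. -/
noncomputable def hInfNorm (F : ℂ → ℂ) : ℝ≥0∞ :=
  ⨆ ω : ℝ, ‖F (Complex.I * (ω : ℂ))‖ₑ

/-- The state coordinates of a system whose `q` distinct Hankel singular values have
multiplicities `m 0, …, m (q - 1)`: coordinate `⟨j, l⟩` is the `l`-th coordinate of the `j`-th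
block, so the order is `m 0 + ⋯ + m (q - 1)`. -/
abbrev BlockIndex {q : ℕ} (m : Fin q → ℕ) : Type := (j : Fin q) × Fin (m j)

/-!
Write `Σ = diag h` for the common Gramian and `p` for the retained coordinates, whose Hankel
singular values are disjoint from those of the others. For an input `u = 1` at the complex
frequency `s`, the singular perturbation approximation has a description in the full state space:
its output is `c x + d`, where `A x + b = s Π x` and `Π` is the projection onto the coordinates
in `p` (`singularPerturbation_apply`, `transferFunction_singularPerturbation_eq`). So all questions
about the approximation become questions about the pencil `A - s Π`.

*Well-posedness and stability.* For `Re s ≥ 0` the kernel of `A - s Π` is zero. On the kernel the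
two Lyapunov equations hold with equality in the dissipation inequality, which makes the kernel
invariant under `Σ²`; an eigenvector of `Σ²` in it lives in one level set of `h`, hence either
inside or outside `p`, and is an eigenvector of `A` for the eigenvalue `s` or `0`
(`exists_mem_level`, `pencil_injective`). The same argument "at `s = ∞`" shows that `A₂₂` is
invertible (`discarded_injective`).

*Upper bound.* Let `x'` and `x` be the states of two approximations such that `x'` retains one more
block, with singular value `σ`. Evaluating the observability Lyapunov form at `x' - x` and the
reachability form at `Σ⁻¹ (x' + x)`, the terms coming from the dynamics cancel on the imaginary
axis, and what is left is `|c (x' - x)|² = σ² (4 - |β - 2|²) ≤ 4 σ²` (`norm_dotProduct_sub_le`).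
Removing the blocks one at a time gives twice the sum of the discarded singular values
(`norm_transferFunction_sub_le`).

*Lower bound.* As `ω → ∞` the error tends to `d - d_r = c₂ A₂₂⁻¹ b₂`. The balancing transformation
to the sign symmetric realization is orthogonal and commutes with `Σ`, since Gramians of stable
systems are unique; so if the signs of the discarded coordinates are all `ε`, then `A₂₂` is
symmetric and `b₂ = ε c₂` already in the given coordinates (`exists_symmetrizer`). The Lyapunov
equation `A₂₂ Σ₂ + Σ₂ A₂₂ + b₂ b₂ᵀ = 0` then gives `c₂ A₂₂⁻¹ b₂ = -2 ε tr Σ₂`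
(`d_sub_singularPerturbation_d`), and `tr Σ₂`, which counts multiplicities, is at least the sum of
the distinct discarded singular values.
-/

namespace SISOSystem

local notation "ℂ⟦" M "⟧" => Matrix.map M Complex.ofReal

section General

variable {ι : Type*} [Fintype ι] [DecidableEq ι]

/-! ### Lyapunov equations as quadratic identities -/

/-- The observability Lyapunov equation `Aᵀ Σ + Σ A + cᵀ c = 0` applied to a complex vector. Used
with `Aᵀ` and `b` in place of `A` and `c`, it is the reachability equation. -/
lemma lyapunov_apply {A : Matrix ι ι ℝ} {h c : ι → ℝ}
    (hA : Aᵀ * Matrix.diagonal h + Matrix.diagonal h * A + Matrix.vecMulVec c c = 0)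
    (z : ι → ℂ) (i : ι) :
    (ℂ⟦Aᵀ⟧ *ᵥ fun j => (h j : ℂ) * z j) i + h i * (ℂ⟦A⟧ *ᵥ z) i
      + c i * ((fun j => (c j : ℂ)) ⬝ᵥ z) = 0 := by
  have h1 : ∀ j, (A j i : ℂ) * h j + h i * A i j + c i * c j = 0 := by
    intro j
    have := congrFun (congrFun hA i) j
    simp only [Matrix.add_apply, Matrix.mul_diagonal, Matrix.diagonal_mul, Matrix.transpose_apply,
      Matrix.vecMulVec_apply, Matrix.zero_apply] at this
    exact_mod_cast this
  simp only [Matrix.mulVec, dotProduct, Matrix.map_apply, Matrix.transpose_apply, Finset.mul_sum,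
    ← Finset.sum_add_distrib]
  refine Finset.sum_eq_zero fun j _ => ?_
  linear_combination z j * h1 j

/-- The dissipation identity `2 Re (z* Σ A z) = -|c z|²`. -/
lemma two_mul_re_lyapunov {A : Matrix ι ι ℝ} {h c : ι → ℝ}
    (hA : Aᵀ * Matrix.diagonal h + Matrix.diagonal h * A + Matrix.vecMulVec c c = 0)
    (z : ι → ℂ) :
    2 * ∑ i, (star (z i) * (h i * (ℂ⟦A⟧ *ᵥ z) i)).re
      = -‖(fun j => (c j : ℂ)) ⬝ᵥ z‖ ^ 2 := by
  have hadj : ∑ i, star (z i) * (ℂ⟦Aᵀ⟧ *ᵥ fun j => (h j : ℂ) * z j) i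
      = star (∑ i, star (z i) * (h i * (ℂ⟦A⟧ *ᵥ z) i)) := by
    simp only [Matrix.mulVec, dotProduct, Matrix.map_apply, Matrix.transpose_apply,
      Finset.mul_sum, star_sum]
    rw [Finset.sum_comm]
    refine Finset.sum_congr rfl fun i _ => Finset.sum_congr rfl fun j _ => ?_
    simp
    ring
  have hc : ∑ i, star (z i) * (c i * ((fun j => (c j : ℂ)) ⬝ᵥ z))
      = ((‖(fun j => (c j : ℂ)) ⬝ᵥ z‖ ^ 2 : ℝ) : ℂ) := by
    rw [Complex.ofReal_pow, ← Complex.conj_mul']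
    simp only [← mul_assoc, ← Finset.sum_mul]
    congr 1
    simp [dotProduct, mul_comm]
  have hsum : ∑ i, star (z i) * ((ℂ⟦Aᵀ⟧ *ᵥ fun j => (h j : ℂ) * z j) i + h i * (ℂ⟦A⟧ *ᵥ z) i
      + c i * ((fun j => (c j : ℂ)) ⬝ᵥ z)) = 0 :=
    Finset.sum_eq_zero fun i _ => by rw [lyapunov_apply hA, mul_zero]
  simp only [mul_add, Finset.sum_add_distrib] at hsum
  rw [hadj, hc] at hsum
  have := congrArg Complex.re hsum
  rw [← Complex.re_sum]
  simp only [Complex.star_def, Complex.add_re, Complex.ofReal_re, Complex.conj_re,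
    Complex.zero_re] at this ⊢
  linarith

/-- If `Re (conj (zᵢ) (A z)ᵢ) ≥ 0` in every coordinate, the dissipation identity is only possible
with `c z = 0`, so that `Aᵀ Σ z = -Σ A z`, and with equality in every coordinate. -/
lemma lyapunov_tangent {A : Matrix ι ι ℝ} {h c : ι → ℝ}
    (hA : Aᵀ * Matrix.diagonal h + Matrix.diagonal h * A + Matrix.vecMulVec c c = 0)
    {z : ι → ℂ} (hz : ∀ i, 0 ≤ (star (z i) * (ℂ⟦A⟧ *ᵥ z) i).re) (hpos : ∀ i, 0 < h i) :
    (∀ i, (ℂ⟦Aᵀ⟧ *ᵥ fun j => (h j : ℂ) * z j) i = -(h i * (ℂ⟦A⟧ *ᵥ z) i)) ∧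
    ∀ i, (star (z i) * (ℂ⟦A⟧ *ᵥ z) i).re = 0 := by
  have key := two_mul_re_lyapunov hA z
  have hterm : ∀ i, (star (z i) * (h i * (ℂ⟦A⟧ *ᵥ z) i)).re
      = h i * (star (z i) * (ℂ⟦A⟧ *ᵥ z) i).re := fun i => by
    rw [mul_left_comm, Complex.re_ofReal_mul]
  simp only [hterm] at key
  have hnn : ∀ i ∈ Finset.univ, 0 ≤ h i * (star (z i) * (ℂ⟦A⟧ *ᵥ z) i).re :=
    fun i _ => mul_nonneg (hpos i).le (hz i)
  have hs := Finset.sum_nonneg hnn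
  have hc : ‖(fun j => (c j : ℂ)) ⬝ᵥ z‖ ^ 2 = 0 := by
    have := sq_nonneg ‖(fun j => (c j : ℂ)) ⬝ᵥ z‖
    linarith
  have hc0 : (fun j => (c j : ℂ)) ⬝ᵥ z = 0 := by simpa using hc
  refine ⟨fun i => ?_, fun i => ?_⟩
  · have := lyapunov_apply hA z i
    rw [hc0] at this
    linear_combination this
  · have h0 : ∑ i, h i * (star (z i) * (ℂ⟦A⟧ *ᵥ z) i).re = 0 := by linarith
    have := (Finset.sum_eq_zero_iff_of_nonneg hnn).1 h0 i (Finset.mem_univ i)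
    exact (mul_eq_zero.1 this).resolve_left (hpos i).ne'

/-- A nonzero invariant subspace of a complex endomorphism contains an eigenvector. -/
lemma exists_eigenvector_mem {V : Type*} [AddCommGroup V] [Module ℂ V] [FiniteDimensional ℂ V]
    (f : V →ₗ[ℂ] V) (K : Submodule ℂ V) (hK : ∀ v ∈ K, f v ∈ K) {v : V} (hv : v ∈ K)
    (hv0 : v ≠ 0) : ∃ (μ : ℂ) (w : V), w ∈ K ∧ w ≠ 0 ∧ f w = μ • w := by
  have : Nontrivial K := ⟨⟨⟨v, hv⟩, 0, fun h => hv0 (congrArg Subtype.val h)⟩⟩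
  obtain ⟨μ, hμ⟩ := Module.End.exists_eigenvalue (f.restrict hK)
  obtain ⟨w, hw⟩ := hμ.exists_hasEigenvector
  refine ⟨μ, w, w.2, fun h => hw.2 (Subtype.ext h), ?_⟩
  exact congrArg Subtype.val hw.apply_eq_smul

/-- The Pernebo–Silverman argument. The vectors `z` with `αᵢ (A z)ᵢ = βᵢ zᵢ`, where in each
coordinate either `(α, β) = (1, β)` with `β` imaginary or `(α, β) = (0, 1)`, form a subspace. By the equality
cases of the two dissipation identities it is invariant under `Σ²`, and `A` intertwines `Σ²` on it.
If it is nonzero, it thus contains an eigenvector `v` of `Σ²`, and then `v` and `A v` are both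
supported in a single level set of `h`. -/
lemma exists_mem_level {A : Matrix ι ι ℝ} {h b c : ι → ℝ} (hpos : ∀ i, 0 < h i)
    (hP : A * Matrix.diagonal h + Matrix.diagonal h * Aᵀ + Matrix.vecMulVec b b = 0)
    (hQ : Aᵀ * Matrix.diagonal h + Matrix.diagonal h * A + Matrix.vecMulVec c c = 0)
    {α β : ι → ℂ} (hαβ : ∀ i, (α i = 1 ∧ (β i).re = 0) ∨ (α i = 0 ∧ β i = 1))
    {z : ι → ℂ} (hz : ∀ i, α i * (ℂ⟦A⟧ *ᵥ z) i = β i * z i) (hz0 : z ≠ 0) :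
    ∃ (i₀ : ι) (v : ι → ℂ), v i₀ ≠ 0 ∧ (∀ i, α i * (ℂ⟦A⟧ *ᵥ v) i = β i * v i) ∧
      ∀ i, h i ≠ h i₀ → v i = 0 ∧ (ℂ⟦A⟧ *ᵥ v) i = 0 := by
  have hre : ∀ (i : ι) (a u : ℂ), α i * a = β i * u → (star u * a).re = 0 := by
    intro i a u hau
    rcases hαβ i with ⟨h1, h2⟩ | ⟨h1, h2⟩
    · rw [h1, one_mul] at hau
      rw [hau]
      simp [h2]
      ring
    · rw [h1, h2, zero_mul, one_mul] at hau
      simp [← hau]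
  have hre' : ∀ (i : ι) (a u : ℂ), α i * a = -(β i * u) → (star u * a).re = 0 := by
    intro i a u hau
    have := hre i (-a) u (by linear_combination -hau)
    rwa [mul_neg, Complex.neg_re, neg_eq_zero] at this
  have hP' : Aᵀᵀ * Matrix.diagonal h + Matrix.diagonal h * Aᵀ + Matrix.vecMulVec b b = 0 := by
    rwa [Matrix.transpose_transpose]
  -- the equality case at `v`, then the one of the reachability form at `Σ v`: `A Σ² v = Σ² A v`
  have hT : ∀ v : ι → ℂ, (∀ i, α i * (ℂ⟦A⟧ *ᵥ v) i = β i * v i) →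
      ∀ i, (ℂ⟦A⟧ *ᵥ fun j => (h j : ℂ) * (h j * v j)) i = h i * (h i * (ℂ⟦A⟧ *ᵥ v) i) := by
    intro v hv
    have h1 := (lyapunov_tangent hQ (fun i => (hre i _ _ (hv i)).ge) hpos).1
    have h2 := (lyapunov_tangent hP' (z := fun j => (h j : ℂ) * v j)
      (fun i => (hre' i _ _ (by rw [h1]; linear_combination -(h i : ℂ) * hv i)).ge) hpos).1
    intro i
    have h3 := h2 i
    rw [Matrix.transpose_transpose] at h3
    rw [h3, h1]
    ring
  let K : Submodule ℂ (ι → ℂ) :=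
    { carrier := {v | ∀ i, α i * (ℂ⟦A⟧ *ᵥ v) i = β i * v i}
      add_mem' := fun {u v} hu hv i => by
        simp only [Set.mem_ofPred_eq] at hu hv
        rw [Matrix.mulVec_add, Pi.add_apply, Pi.add_apply, mul_add, mul_add, hu, hv]
      zero_mem' := fun i => by simp
      smul_mem' := fun r v hv i => by
        simp only [Set.mem_ofPred_eq] at hv
        rw [Matrix.mulVec_smul, Pi.smul_apply, Pi.smul_apply, smul_eq_mul, smul_eq_mul]
        linear_combination r * hv i }
  let f : (ι → ℂ) →ₗ[ℂ] (ι → ℂ) := Matrix.toLin' (Matrix.diagonal fun i => (h i : ℂ) * h i)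
  have hf : ∀ v : ι → ℂ, f v = fun j => (h j : ℂ) * (h j * v j) := fun v => by
    funext j
    simp [f, Matrix.mulVec_diagonal, mul_assoc]
  obtain ⟨μ, v, hvK, hv0, hμ⟩ := exists_eigenvector_mem f K (fun v hv i => by
    rw [hf, hT v hv]
    linear_combination (h i : ℂ) * h i * hv i) (v := z) hz hz0
  obtain ⟨i₀, hi₀⟩ := Function.ne_iff.1 hv0
  have hμi : ∀ i, (h i : ℂ) * (h i * v i) = μ * v i := fun i => by
    have := congrFun hμ i
    rwa [hf] at this
  have hμ0 : μ = (h i₀ : ℂ) * h i₀ := by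
    refine mul_right_cancel₀ hi₀ ?_
    linear_combination -hμi i₀
  have hsub : ∀ (i : ι) (u : ℂ), (h i : ℂ) * (h i * u) = μ * u → h i ≠ h i₀ → u = 0 := by
    intro i u hu hne
    rw [hμ0] at hu
    have h1 : ((h i - h i₀ : ℝ) : ℂ) * (((h i + h i₀ : ℝ) : ℂ) * u) = 0 := by
      push_cast
      linear_combination hu
    have h2 : ((h i - h i₀ : ℝ) : ℂ) ≠ 0 := by exact_mod_cast sub_ne_zero.2 hne
    have h3 : ((h i + h i₀ : ℝ) : ℂ) ≠ 0 := by
      exact_mod_cast (add_pos (hpos i) (hpos i₀)).ne'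
    exact (mul_eq_zero.1 ((mul_eq_zero.1 h1).resolve_left h2)).resolve_left h3
  refine ⟨i₀, v, hi₀, hvK, fun i hi => ⟨hsub i _ (hμi i) hi, hsub i _ ?_ hi⟩⟩
  rw [← hT v hvK i, ← hf, hμ, Matrix.mulVec_smul, Pi.smul_apply, smul_eq_mul]

/-- A stable matrix has no eigenvector for an eigenvalue in the closed right half plane. -/
lemma not_mulVec_eq_smul {A : Matrix ι ι ℝ} (hA : ∀ z ∈ spectrum ℂ (ℂ⟦A⟧), z.re < 0)
    {s : ℂ} (hs : 0 ≤ s.re) {v : ι → ℂ} (hv : ∀ i, (ℂ⟦A⟧ *ᵥ v) i = s * v i) : v = 0 := by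
  by_contra hv0
  refine absurd (hA s ?_) hs.not_gt
  rw [← Matrix.spectrum_toLin']
  refine (Module.End.hasEigenvalue_of_hasEigenvector (x := v) ⟨?_, hv0⟩).mem_spectrum
  rw [Module.End.mem_eigenspace_iff]
  ext i
  simpa using hv i

/-- `A - s Π` has trivial kernel for `Re s ≥ 0`, where `Π` is the projection onto a union `p` of
level sets of the Gramian. -/
lemma pencil_injective {A : Matrix ι ι ℝ} {h b c : ι → ℝ} (hpos : ∀ i, 0 < h i)
    (hA : ∀ z ∈ spectrum ℂ (ℂ⟦A⟧), z.re < 0)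
    (hP : A * Matrix.diagonal h + Matrix.diagonal h * Aᵀ + Matrix.vecMulVec b b = 0)
    (hQ : Aᵀ * Matrix.diagonal h + Matrix.diagonal h * A + Matrix.vecMulVec c c = 0)
    {p : ι → Prop} [DecidablePred p] (hp : ∀ i j, p i → ¬ p j → h i ≠ h j)
    {s : ℂ} (hs : 0 ≤ s.re) {z : ι → ℂ}
    (hz : ∀ i, (ℂ⟦A⟧ *ᵥ z) i = (if p i then s else 0) * z i) : z = 0 := by
  by_contra hz0
  -- off the imaginary axis the dissipation inequality forces `z` to vanish on `p`
  obtain ⟨t, ht, hzt⟩ : ∃ t : ℂ, t.re = 0 ∧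
      ∀ i, (ℂ⟦A⟧ *ᵥ z) i = (if p i then t else 0) * z i := by
    rcases hs.eq_or_lt with hs0 | hs0
    · exact ⟨s, hs0.symm, hz⟩
    · refine ⟨0, rfl, fun i => ?_⟩
      have hre : ∀ i, (star (z i) * (ℂ⟦A⟧ *ᵥ z) i).re
          = (if p i then s.re else 0) * Complex.normSq (z i) := fun i => by
        rw [hz, mul_left_comm, Complex.star_def, ← Complex.normSq_eq_conj_mul_self,
          Complex.re_mul_ofReal]
        split_ifs <;> simp
      have h0 := (lyapunov_tangent hQ (z := z) (fun i => by
        rw [hre]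
        exact mul_nonneg (by split_ifs <;> simp [hs]) (Complex.normSq_nonneg _)) hpos).2 i
      rw [hre] at h0
      rw [hz]
      split_ifs with hpi
      · rw [if_pos hpi] at h0
        have := Complex.normSq_eq_zero.1 ((mul_eq_zero.1 h0).resolve_left hs0.ne')
        simp [this]
      · rfl
  obtain ⟨i₀, v, hv0, hv, hlev⟩ := exists_mem_level hpos hP hQ (α := fun _ => 1)
    (β := fun i => if p i then t else 0)
    (fun i => Or.inl ⟨rfl, by split_ifs <;> simp [ht]⟩)
    (fun i => by rw [one_mul]; exact hzt i) hz0
  refine hv0 ?_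
  by_cases hi₀ : p i₀
  · refine congrFun (not_mulVec_eq_smul hA ht.ge fun i => ?_) i₀
    by_cases hi : p i
    · simpa [hi] using hv i
    · obtain ⟨h1, h2⟩ := hlev i (hp _ _ hi₀ hi).symm
      rw [h1, h2, mul_zero]
  · refine congrFun (not_mulVec_eq_smul hA (s := 0) le_rfl fun i => ?_) i₀
    by_cases hi : p i
    · obtain ⟨h1, h2⟩ := hlev i (hp _ _ hi hi₀)
      rw [h1, h2, mul_zero]
    · simpa [hi] using hv i

/-- The discarded block `A₂₂` has trivial kernel: for `z` supported outside `p`, `(A z)ᵢ` is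
`(A₂₂ z)ᵢ` in the discarded coordinates. -/
lemma discarded_injective {A : Matrix ι ι ℝ} {h b c : ι → ℝ} (hpos : ∀ i, 0 < h i)
    (hA : ∀ z ∈ spectrum ℂ (ℂ⟦A⟧), z.re < 0)
    (hP : A * Matrix.diagonal h + Matrix.diagonal h * Aᵀ + Matrix.vecMulVec b b = 0)
    (hQ : Aᵀ * Matrix.diagonal h + Matrix.diagonal h * A + Matrix.vecMulVec c c = 0)
    {p : ι → Prop} [DecidablePred p] (hp : ∀ i j, p i → ¬ p j → h i ≠ h j)
    {z : ι → ℂ} (hz : ∀ i, p i → z i = 0) (hAz : ∀ i, ¬ p i → (ℂ⟦A⟧ *ᵥ z) i = 0) : z = 0 := by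
  by_contra hz0
  obtain ⟨i₀, v, hv0, hv, hlev⟩ := exists_mem_level hpos hP hQ
    (α := fun i => if p i then 0 else 1) (β := fun i => if p i then 1 else 0)
    (fun i => by by_cases hi : p i <;> simp [hi])
    (z := z) (fun i => by by_cases hi : p i <;> simp [hi, hz, hAz]) hz0
  have hi₀ : ¬ p i₀ := fun hi => hv0 (by simpa [hi] using (hv i₀).symm)
  refine hv0 (congrFun (not_mulVec_eq_smul hA (s := 0) le_rfl fun i => ?_) i₀)
  by_cases hi : p i
  · obtain ⟨h1, h2⟩ := hlev i (hp _ _ hi hi₀)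
    rw [h1, h2, mul_zero]
  · simpa [hi] using hv i

/-! ### Casting real matrices to complex ones -/

lemma map_ofReal_mul {l m n : Type*} [Fintype m] (M : Matrix l m ℝ) (N : Matrix m n ℝ) :
    ℂ⟦M * N⟧ = ℂ⟦M⟧ * ℂ⟦N⟧ :=
  Matrix.map_mul (f := Complex.ofRealHom)

lemma map_ofReal_sub {m n : Type*} (M N : Matrix m n ℝ) : ℂ⟦M - N⟧ = ℂ⟦M⟧ - ℂ⟦N⟧ := by
  ext
  simp

lemma ofReal_mulVec {m n : Type*} [Fintype n] (M : Matrix m n ℝ) (v : n → ℝ) (i : m) :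
    (((M *ᵥ v) i : ℝ) : ℂ) = (ℂ⟦M⟧ *ᵥ fun j => (v j : ℂ)) i := by
  simp [Matrix.mulVec, dotProduct]

lemma ofReal_vecMul {m n : Type*} [Fintype m] (M : Matrix m n ℝ) (v : m → ℝ) (i : n) :
    (((v ᵥ* M) i : ℝ) : ℂ) = ((fun j => (v j : ℂ)) ᵥ* ℂ⟦M⟧) i := by
  simp [Matrix.vecMul, dotProduct]

lemma ofReal_dotProduct {n : Type*} [Fintype n] (v w : n → ℝ) :
    ((v ⬝ᵥ w : ℝ) : ℂ) = (fun j => (v j : ℂ)) ⬝ᵥ fun j => (w j : ℂ) := by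
  simp [dotProduct]

lemma mulVec_eq_toBlock_add {m n : Type*} [Fintype n] (p : n → Prop) [DecidablePred p]
    (f : m → n) (M : Matrix n n ℝ) (x : n → ℂ) :
    (fun i => (ℂ⟦M⟧ *ᵥ x) (f i)) =
      (ℂ⟦M.submatrix f (Subtype.val : {j // p j} → n)⟧ *ᵥ fun j => x j) +
      ℂ⟦M.submatrix f (Subtype.val : {j // ¬ p j} → n)⟧ *ᵥ fun j => x j := by
  ext i
  simp only [Matrix.mulVec, dotProduct, Pi.add_apply, Matrix.map_apply, Matrix.submatrix_apply]
  exact (Fintype.sum_subtype_add_sum_subtype p fun j => (M (f i) j : ℂ) * x j).symm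

lemma map_ofReal_one {n : Type*} [DecidableEq n] : ℂ⟦(1 : Matrix n n ℝ)⟧ = 1 :=
  Matrix.map_one _ Complex.ofReal_zero Complex.ofReal_one

/-! ### The singular perturbation approximation in the full state space -/

lemma isUnit_discardedBlock {G : SISOSystem ι} {h : ι → ℝ} (hbal : G.IsBalanced h)
    (hst : G.AsymptoticallyStable) (hpos : ∀ i, 0 < h i)
    {p : ι → Prop} [DecidablePred p] (hp : ∀ i j, p i → ¬ p j → h i ≠ h j) :
    IsUnit (G.discardedBlock p) := by
  rw [← Matrix.mulVec_injective_iff_isUnit]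
  refine (injective_iff_map_eq_zero (Matrix.mulVecLin (G.discardedBlock p))).2 fun v hv => ?_
  let z : ι → ℂ := fun i => if hi : p i then 0 else (v ⟨i, hi⟩ : ℂ)
  have h1 : (fun i : {i // p i} => z i) = 0 := by
    ext i
    simp [z, i.2]
  have h2 : (fun i : {i // ¬ p i} => z i) = fun i => (v i : ℂ) := by
    ext i
    simp [z, i.2]
  have hz := discarded_injective hpos hst hbal.1.2 hbal.2.2 hp (z := z)
    (fun i hi => congrFun h1 ⟨i, hi⟩) (fun i hi => by
      have h3 := congrFun (mulVec_eq_toBlock_add p (Subtype.val : {j // ¬ p j} → ι) G.A z) ⟨i, hi⟩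
      rw [h1, h2, Matrix.mulVec_zero, zero_add] at h3
      refine h3.trans ((ofReal_mulVec (G.discardedBlock p) v ⟨i, hi⟩).symm.trans ?_)
      exact congrArg Complex.ofReal (congrFun hv ⟨i, hi⟩))
  ext i
  simpa [z, i.2] using congrFun hz i

variable {G : SISOSystem ι} {p : ι → Prop} [DecidablePred p]

/-- If the state `x` and the input `u` satisfy the algebraic constraint
`A₂₁ x₁ + A₂₂ x₂ + b₂ u = 0`, then the approximation at `x₁` has the same state derivative in the retained coordinates, and the
same output, as the full system at `x`. -/
lemma singularPerturbation_apply (hunit : IsUnit (G.discardedBlock p)) {x : ι → ℂ} {u : ℂ}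
    (hx : ∀ i, ¬ p i → (ℂ⟦G.A⟧ *ᵥ x) i + u * G.b i = 0) :
    (∀ i : {i // p i}, (ℂ⟦(G.singularPerturbation p).A⟧ *ᵥ fun j => x j) i
        + u * (G.singularPerturbation p).b i = (ℂ⟦G.A⟧ *ᵥ x) i + u * G.b i) ∧
      ((fun i => ((G.singularPerturbation p).c i : ℂ)) ⬝ᵥ fun j => x j)
        + u * (G.singularPerturbation p).d = (fun i => (G.c i : ℂ)) ⬝ᵥ x + u * G.d := by
  set B := ℂ⟦(G.discardedBlock p)⁻¹⟧ with hB
  set x₁ : {i // p i} → ℂ := fun j => x j with hx₁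
  set x₂ : {i // ¬ p i} → ℂ := fun j => x j with hx₂
  set a₂₁ := ℂ⟦G.A.toBlock (fun i => ¬ p i) p⟧ with ha₂₁
  set a₁₂ := ℂ⟦G.A.toBlock p (fun i => ¬ p i)⟧ with ha₁₂
  set b₂ : {i // ¬ p i} → ℂ := fun j => G.b j with hb₂
  set c₂ : {i // ¬ p i} → ℂ := fun j => G.c j with hc₂
  have hBA : B * ℂ⟦G.discardedBlock p⟧ = 1 := by
    rw [hB, ← map_ofReal_mul, Matrix.nonsing_inv_mul _ ((Matrix.isUnit_iff_isUnit_det _).1 hunit),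
      map_ofReal_one]
  have h2 : a₂₁ *ᵥ x₁ + ℂ⟦G.discardedBlock p⟧ *ᵥ x₂ + u • b₂ = 0 := by
    ext i
    have := mulVec_eq_toBlock_add p (Subtype.val : {j // ¬ p j} → ι) G.A x
    have h3 := hx i i.2
    rw [congrFun this i] at h3
    exact h3
  have h3 : x₂ = -(B *ᵥ (a₂₁ *ᵥ x₁) + u • B *ᵥ b₂) := by
    have := congrArg (B *ᵥ ·) h2
    simp only [Matrix.mulVec_add, Matrix.mulVec_mulVec, hBA, Matrix.one_mulVec, Matrix.mulVec_zero,
      Matrix.mulVec_smul] at this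
    rw [Matrix.mulVec_mulVec]
    linear_combination (exp := 1) this
  constructor
  · intro i
    have h4 := congrFun (mulVec_eq_toBlock_add p (Subtype.val : {j // p j} → ι) G.A x) i
    have h5 : (ℂ⟦G.A⟧ *ᵥ x) i = (ℂ⟦G.A.toBlock p p⟧ *ᵥ x₁) i + (a₁₂ *ᵥ x₂) i := h4
    have h6 : ℂ⟦(G.singularPerturbation p).A⟧ = ℂ⟦G.A.toBlock p p⟧ - a₁₂ * B * a₂₁ := by
      rw [singularPerturbation, map_ofReal_sub, map_ofReal_mul, map_ofReal_mul]
    have h7 : (((G.singularPerturbation p).b i : ℝ) : ℂ) = G.b i - ((a₁₂ * B) *ᵥ b₂) i := by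
      simp only [singularPerturbation, Pi.sub_apply, Complex.ofReal_sub]
      rw [ofReal_mulVec, map_ofReal_mul]
    rw [h5, h6, h7, h3, Matrix.sub_mulVec, Matrix.mulVec_neg, Matrix.mulVec_add,
      Matrix.mulVec_smul, ← Matrix.mulVec_mulVec, ← Matrix.mulVec_mulVec, ← Matrix.mulVec_mulVec]
    simp only [Pi.sub_apply, Pi.neg_apply, Pi.add_apply, Pi.smul_apply, smul_eq_mul]
    ring
  · have h4 : (fun i => (G.c i : ℂ)) ⬝ᵥ x = (fun i : {i // p i} => (G.c i : ℂ)) ⬝ᵥ x₁ + c₂ ⬝ᵥ x₂ :=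
      (Fintype.sum_subtype_add_sum_subtype p fun j => (G.c j : ℂ) * x j).symm
    have h5 : (fun i => ((G.singularPerturbation p).c i : ℂ))
        = (fun i : {i // p i} => (G.c i : ℂ)) - c₂ ᵥ* (B * a₂₁) := by
      ext i
      simp only [singularPerturbation, Pi.sub_apply, Complex.ofReal_sub]
      rw [ofReal_vecMul, map_ofReal_mul]
    have h6 : (((G.singularPerturbation p).d : ℝ) : ℂ) = G.d - c₂ ⬝ᵥ (B *ᵥ b₂) := by
      simp only [singularPerturbation, Complex.ofReal_sub]
      rw [ofReal_dotProduct]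
      congr 2
      ext i
      rw [ofReal_mulVec]
    rw [h4, h5, h6, h3, sub_dotProduct, dotProduct_neg, dotProduct_add, dotProduct_smul,
      ← Matrix.dotProduct_mulVec, Matrix.mulVec_mulVec, smul_eq_mul]
    ring

/-- Every retained state `w` extends to a state `x` with `x₁ = w` and `A₂₁ x₁ + A₂₂ x₂ = 0`. -/
lemma exists_singularPerturbation_lift (hunit : IsUnit (G.discardedBlock p))
    (w : {i // p i} → ℂ) : ∃ x : ι → ℂ, (fun i : {i // p i} => x i) = w ∧
      ∀ i, ¬ p i → (ℂ⟦G.A⟧ *ᵥ x) i = 0 := by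
  set B := ℂ⟦(G.discardedBlock p)⁻¹⟧ with hB
  set a₂₁ := ℂ⟦G.A.toBlock (fun i => ¬ p i) p⟧ with ha₂₁
  have hAB : ℂ⟦G.discardedBlock p⟧ * B = 1 := by
    rw [hB, ← map_ofReal_mul, Matrix.mul_nonsing_inv _ ((Matrix.isUnit_iff_isUnit_det _).1 hunit),
      map_ofReal_one]
  let x : ι → ℂ := fun i => if hi : p i then w ⟨i, hi⟩ else -(B *ᵥ (a₂₁ *ᵥ w)) ⟨i, hi⟩
  have h1 : (fun i : {i // p i} => x i) = w := by
    ext i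
    simp [x, i.2]
  have h2 : (fun i : {i // ¬ p i} => x i) = -(B *ᵥ (a₂₁ *ᵥ w)) := by
    ext i
    simp [x, i.2]
  refine ⟨x, h1, fun i hi => ?_⟩
  have h3 := congrFun (mulVec_eq_toBlock_add p (Subtype.val : {j // ¬ p j} → ι) G.A x)
    ⟨i, hi⟩
  rw [h1, h2] at h3
  refine h3.trans ?_
  change (a₂₁ *ᵥ w + ℂ⟦G.discardedBlock p⟧ *ᵥ (-(B *ᵥ (a₂₁ *ᵥ w)))) ⟨i, hi⟩ = 0
  rw [Matrix.mulVec_neg, Matrix.mulVec_mulVec, hAB, Matrix.one_mulVec, add_neg_cancel,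
    Pi.zero_apply]

lemma asymptoticallyStable_singularPerturbation {h : ι → ℝ} (hbal : G.IsBalanced h)
    (hst : G.AsymptoticallyStable) (hpos : ∀ i, 0 < h i)
    (hp : ∀ i j, p i → ¬ p j → h i ≠ h j) :
    (G.singularPerturbation p).AsymptoticallyStable := by
  have hunit := isUnit_discardedBlock hbal hst hpos hp
  intro s hs
  by_contra! hre
  rw [← Matrix.spectrum_toLin', ← Module.End.hasEigenvalue_iff_mem_spectrum] at hs
  obtain ⟨w, hw⟩ := hs.exists_hasEigenvector
  obtain ⟨x, rfl, hx⟩ := exists_singularPerturbation_lift hunit w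
  have hx' := (singularPerturbation_apply hunit (u := 0) (x := x) (by simpa using hx)).1
  refine hw.2 ?_
  have hx0 : x = 0 := pencil_injective hpos hst hbal.1.2 hbal.2.2 hp hre fun i => by
    by_cases hi : p i
    · have h1 := congrFun hw.apply_eq_smul ⟨i, hi⟩
      have h2 := hx' ⟨i, hi⟩
      simp only [zero_mul, add_zero] at h2
      rw [← h2]
      simpa [hi] using h1
    · simpa [hi] using hx i hi
  ext i
  simp [hx0]

lemma transferFunction_eq (hst : G.AsymptoticallyStable) {s : ℂ} (hs : 0 ≤ s.re) {x : ι → ℂ}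
    (hx : ∀ i, (ℂ⟦G.A⟧ *ᵥ x) i + G.b i = s * x i) :
    G.transferFunction s = (fun i => (G.c i : ℂ)) ⬝ᵥ x + G.d := by
  have hs' : s ∉ spectrum ℂ ℂ⟦G.A⟧ := fun h => (hst s h).not_ge hs
  rw [spectrum.notMem_iff, Algebra.algebraMap_eq_smul_one, Matrix.isUnit_iff_isUnit_det] at hs'
  have h1 : (s • (1 : Matrix ι ι ℂ) - ℂ⟦G.A⟧) *ᵥ x = fun i => (G.b i : ℂ) := by
    ext i
    rw [Matrix.sub_mulVec, Matrix.smul_mulVec, Matrix.one_mulVec, Pi.sub_apply, Pi.smul_apply,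
      smul_eq_mul, ← hx i]
    ring
  rw [transferFunction, ← h1, Matrix.mulVec_mulVec, Matrix.nonsing_inv_mul _ hs',
    Matrix.one_mulVec]

/-- The transfer function of the approximation is `c x + d`, where `A x + b = s Π x`. -/
lemma transferFunction_singularPerturbation_eq {h : ι → ℝ} (hbal : G.IsBalanced h)
    (hst : G.AsymptoticallyStable) (hpos : ∀ i, 0 < h i)
    (hp : ∀ i j, p i → ¬ p j → h i ≠ h j) {s : ℂ} (hs : 0 ≤ s.re) {x : ι → ℂ}
    (hx : ∀ i, (ℂ⟦G.A⟧ *ᵥ x) i + G.b i = (if p i then s else 0) * x i) :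
    (G.singularPerturbation p).transferFunction s = (fun i => (G.c i : ℂ)) ⬝ᵥ x + G.d := by
  have hunit := isUnit_discardedBlock hbal hst hpos hp
  obtain ⟨h1, h2⟩ := singularPerturbation_apply hunit (u := 1) (x := x) fun i hi => by
    simpa [hi] using hx i
  simp only [one_mul] at h1 h2
  rw [← h2, transferFunction_eq (asymptoticallyStable_singularPerturbation hbal hst hpos hp) hs]
  intro i
  rw [h1, hx, if_pos i.2]

/-- The full-space equation `A x + b = s Π x` of the approximation is solvable for `Re s ≥ 0`. -/
lemma exists_pencil_solution {h : ι → ℝ} (hbal : G.IsBalanced h)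
    (hst : G.AsymptoticallyStable) (hpos : ∀ i, 0 < h i)
    (hp : ∀ i j, p i → ¬ p j → h i ≠ h j) {s : ℂ} (hs : 0 ≤ s.re) :
    ∃ x : ι → ℂ, ∀ i, (ℂ⟦G.A⟧ *ᵥ x) i + G.b i = (if p i then s else 0) * x i := by
  let M := Matrix.diagonal (fun i => if p i then s else 0) - ℂ⟦G.A⟧
  have hM : ∀ x i, (M *ᵥ x) i = (if p i then s else 0) * x i - (ℂ⟦G.A⟧ *ᵥ x) i := fun x i => by
    rw [Matrix.sub_mulVec, Pi.sub_apply, Matrix.mulVec_diagonal]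
  have hinj : Function.Injective M.mulVec :=
    (injective_iff_map_eq_zero (Matrix.mulVecLin M)).2 fun v hv =>
      pencil_injective hpos hst hbal.1.2 hbal.2.2 hp hs fun i => by
        have := congrFun hv i
        rw [Matrix.mulVecLin_apply, hM] at this
        exact (sub_eq_zero.1 this).symm
  obtain ⟨x, hx⟩ := Matrix.mulVec_surjective_iff_isUnit.2
    (Matrix.mulVec_injective_iff_isUnit.1 hinj) fun i => (G.b i : ℂ)
  refine ⟨x, fun i => ?_⟩
  rw [← congrFun hx i, hM]
  ring

/-! ### Removing one block -/

/-- Discarding the coordinates `p' \ p`, in which the Gramian is the constant `σ`, changes the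
output at a frequency on the imaginary axis by at most `2 σ`. The observability form is evaluated at
`z = x' - x` and the reachability form, weighted with `σ²`, at `y = Σ⁻¹ (x' + x)`. -/
lemma norm_dotProduct_sub_le {A : Matrix ι ι ℝ} {h b c : ι → ℝ} (hpos : ∀ i, 0 < h i)
    (hP : A * Matrix.diagonal h + Matrix.diagonal h * Aᵀ + Matrix.vecMulVec b b = 0)
    (hQ : Aᵀ * Matrix.diagonal h + Matrix.diagonal h * A + Matrix.vecMulVec c c = 0)
    {p p' : ι → Prop} [DecidablePred p] [DecidablePred p'] (hpp' : ∀ i, p i → p' i)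
    {σ : ℝ} (hσ : 0 ≤ σ) (hσh : ∀ i, p' i → ¬ p i → h i = σ) {s : ℂ} (hs : s.re = 0)
    {x x' : ι → ℂ}
    (hx : ∀ i, (ℂ⟦A⟧ *ᵥ x) i + b i = (if p i then s else 0) * x i)
    (hx' : ∀ i, (ℂ⟦A⟧ *ᵥ x') i + b i = (if p' i then s else 0) * x' i) :
    ‖(fun i => (c i : ℂ)) ⬝ᵥ (x' - x)‖ ≤ 2 * σ := by
  have hP' : Aᵀᵀ * Matrix.diagonal h + Matrix.diagonal h * Aᵀ + Matrix.vecMulVec b b = 0 := by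
    rwa [Matrix.transpose_transpose]
  have hne : ∀ i, (h i : ℂ) ≠ 0 := fun i => by exact_mod_cast (hpos i).ne'
  have hskew : ∀ (r : ℝ) (u : ℂ), (star u * (r * (s * u))).re = 0 := fun r u => by
    simp [hs]
    ring
  let z := x' - x
  let y : ι → ℂ := fun i => (h i : ℂ)⁻¹ * (x' i + x i)
  set β := (fun j => (b j : ℂ)) ⬝ᵥ y with hβ
  have hobs := two_mul_re_lyapunov hQ z
  have hrea := two_mul_re_lyapunov hP' y
  have hy : (fun j => (h j : ℂ) * y j) = x' + x := by
    ext j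
    simp [y, mul_inv_cancel_left₀ (hne j)]
  have hAz : ∀ i, (ℂ⟦A⟧ *ᵥ z) i
      = (if p' i then s else 0) * x' i - (if p i then s else 0) * x i := fun i => by
    rw [Matrix.mulVec_sub, Pi.sub_apply, ← hx, ← hx']
    ring
  have hAw : ∀ i, h i * (ℂ⟦Aᵀ⟧ *ᵥ y) i = 2 * b i - b i * β
      - (if p' i then s else 0) * x' i - (if p i then s else 0) * x i := fun i => by
    have := lyapunov_apply hP' y i
    rw [hy, Matrix.transpose_transpose, Matrix.mulVec_add, Pi.add_apply] at this
    linear_combination this - hx i - hx' i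
  -- the supply rates of both storage functions cancel coordinate by coordinate
  have hterm : ∀ i, (star (z i) * (h i * (ℂ⟦A⟧ *ᵥ z) i)).re
      - σ ^ 2 * (star (y i) * (h i * (ℂ⟦Aᵀ⟧ *ᵥ y) i)).re
      = -σ ^ 2 * (star (y i) * (b i * (2 - β))).re := fun i => by
    have hcancel : (star (z i) * (h i * (ℂ⟦A⟧ *ᵥ z) i)).re
        + σ ^ 2 * (star (y i) * ((if p' i then s else 0) * x' i
          + (if p i then s else 0) * x i)).re = 0 := by
      rw [hAz]
      by_cases h1 : p i
      · have e1 : star (z i) * (h i * (s * x' i - s * x i)) = star (z i) * (h i * (s * z i)) := by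
          simp only [z, Pi.sub_apply]
          ring
        have e2 : star (y i) * (s * x' i + s * x i) = star (y i) * (h i * (s * y i)) := by
          have := congrFun hy i
          simp only [Pi.add_apply] at this
          linear_combination -(star (y i) * s) * this
        rw [if_pos h1, if_pos (hpp' i h1), e1, e2, hskew, hskew, mul_zero, add_zero]
      · by_cases h2 : p' i
        · have e1 : star (z i) * (h i * (s * x' i - 0 * x i))
              + ((σ ^ 2 : ℝ) : ℂ) * (star (y i) * (s * x' i + 0 * x i))
              = star (x' i) * (((2 * σ : ℝ) : ℂ) * (s * x' i)) := by
            have h3 := congrArg star (congrFun hy i)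
            simp only [Pi.add_apply, star_mul', star_add, hσh i h2 h1, Complex.star_def,
              Complex.conj_ofReal] at h3
            simp only [z, Pi.sub_apply, star_sub, hσh i h2 h1, Complex.star_def]
            push_cast
            linear_combination (σ * s * x' i) * h3
          rw [if_pos h2, if_neg h1, ← Complex.re_ofReal_mul, ← Complex.add_re, e1, hskew]
        · simp [h1, h2]
    rw [hAw]
    have : star (y i) * (2 * b i - b i * β - (if p' i then s else 0) * x' i
        - (if p i then s else 0) * x i) = star (y i) * (b i * (2 - β))
        - star (y i) * ((if p' i then s else 0) * x' i + (if p i then s else 0) * x i) := by ring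
    rw [this, Complex.sub_re]
    linear_combination hcancel
  have hsum : ∑ i, (star (y i) * (b i * (2 - β))).re = (star β * (2 - β)).re := by
    rw [← Complex.re_sum]
    congr 1
    simp only [← mul_assoc, ← Finset.sum_mul]
    congr 1
    simp [hβ, dotProduct, mul_comm]
  have htot : -‖(fun i => (c i : ℂ)) ⬝ᵥ z‖ ^ 2 + σ ^ 2 * ‖β‖ ^ 2
      = -2 * σ ^ 2 * (star β * (2 - β)).re := by
    rw [← hsum, ← hobs]
    have := Finset.sum_congr rfl fun i (_ : i ∈ Finset.univ) => hterm i
    rw [Finset.sum_sub_distrib, ← Finset.mul_sum, ← Finset.mul_sum] at this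
    linear_combination 2 * this + σ ^ 2 * hrea
  have hβ2 : (star β * (2 - β)).re = 2 * β.re - ‖β‖ ^ 2 := by
    rw [Complex.sq_norm, Complex.normSq_apply]
    simp
    ring
  rw [hβ2] at htot
  have hβ3 : ‖β‖ ^ 2 = β.re ^ 2 + β.im ^ 2 := by
    rw [Complex.sq_norm, Complex.normSq_apply]
    ring
  -- `|c z|² = σ² (4 Re β - |β|²) = σ² (4 - |β - 2|²)`
  refine le_of_sq_le_sq ?_ (by positivity)
  nlinarith [mul_nonneg (sq_nonneg σ) (add_nonneg (sq_nonneg (β.re - 2)) (sq_nonneg β.im))]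

/-! ### The value at infinity -/

lemma tendsto_transferFunction (G : SISOSystem ι) :
    Filter.Tendsto (fun ω : ℝ => G.transferFunction (Complex.I * ω)) Filter.atTop
      (nhds (G.d : ℂ)) := by
  -- any norm that makes matrices a normed algebra gives the decay of the resolvent
  let : NormedRing (Matrix ι ι ℂ) := Matrix.linftyOpNormedRing
  let : NormedAlgebra ℂ (Matrix ι ι ℂ) := Matrix.linftyOpNormedAlgebra
  have h1 : Filter.Tendsto (fun ω : ℝ => Complex.I * ω) Filter.atTop (Bornology.cobounded ℂ) := by
    rw [← tendsto_norm_atTop_iff_cobounded]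
    simpa using Filter.tendsto_abs_atTop_atTop
  have h2 := (spectrum.resolvent_tendsto_cobounded (𝕜 := ℂ) ℂ⟦G.A⟧).comp h1
  have h3 : Continuous fun M : Matrix ι ι ℂ =>
      (fun i => (G.c i : ℂ)) ⬝ᵥ (M *ᵥ fun i => (G.b i : ℂ)) + (G.d : ℂ) := by
    fun_prop
  have h4 := (h3.tendsto 0).comp h2
  simpa [Function.comp_def, resolvent, transferFunction, Algebra.algebraMap_eq_smul_one,
    Matrix.nonsing_inv_eq_ringInverse] using h4

/-! ### Sign symmetry -/

/-- For stable `A` the Lyapunov equation `A X + X Aᵀ = 0` has only the trivial solution: left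
multiplication by `A` preserves the space of solutions, and an eigenmatrix `Y` for the eigenvalue
`μ` would make both `μ` (on its columns) and `-μ` (on its rows) eigenvalues of `A`. -/
lemma eq_zero_of_mul_add_mul_transpose {A X : Matrix ι ι ℝ}
    (hA : ∀ z ∈ spectrum ℂ (ℂ⟦A⟧), z.re < 0) (hX : A * X + X * Aᵀ = 0) : X = 0 := by
  by_contra hX0
  have hXC : ℂ⟦A⟧ * ℂ⟦X⟧ = -(ℂ⟦X⟧ * ℂ⟦A⟧ᵀ) := by
    have := congrArg (fun M => ℂ⟦M⟧) (eq_neg_of_add_eq_zero_left hX)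
    simp only [map_ofReal_mul] at this
    rw [this]
    ext i j
    simp [Matrix.mul_apply]
  -- the space of all complex solutions
  let K : Submodule ℂ (Matrix ι ι ℂ) :=
    { carrier := {Y | ℂ⟦A⟧ * Y = -(Y * ℂ⟦A⟧ᵀ)}
      add_mem' := fun {Y Z} hY hZ => by
        simp only [Set.mem_ofPred_eq] at hY hZ ⊢
        rw [mul_add, hY, hZ, add_mul, neg_add]
      zero_mem' := by simp
      smul_mem' := fun r Y hY => by
        simp only [Set.mem_ofPred_eq] at hY ⊢
        rw [Matrix.mul_smul, hY, Matrix.smul_mul, smul_neg] }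
  obtain ⟨μ, Y, hYK, hY0, hY⟩ := exists_eigenvector_mem (LinearMap.mulLeft ℂ ℂ⟦A⟧) K
    (fun Y hY => by
      change ℂ⟦A⟧ * (ℂ⟦A⟧ * Y) = -(ℂ⟦A⟧ * Y * ℂ⟦A⟧ᵀ)
      conv_lhs => rw [show ℂ⟦A⟧ * Y = _ from hY]
      rw [mul_neg, mul_assoc]) (v := ℂ⟦X⟧) hXC
    (fun h => hX0 (by ext i j; simpa using congrFun (congrFun h i) j))
  have hAY : ℂ⟦A⟧ * Y = μ • Y := hY
  have hYA : ℂ⟦A⟧ * Yᵀ = (-μ) • Yᵀ := by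
    have h1 : Y * ℂ⟦A⟧ᵀ = (-μ) • Y := by
      rw [neg_smul, ← hAY, show ℂ⟦A⟧ * Y = _ from hYK, neg_neg]
    have := congrArg Matrix.transpose h1
    rwa [Matrix.transpose_mul, Matrix.transpose_transpose, Matrix.transpose_smul] at this
  have hcol : ∀ {ν : ℂ} {Z : Matrix ι ι ℂ}, ℂ⟦A⟧ * Z = ν • Z → 0 ≤ ν.re → Z = 0 := by
    intro ν Z hZ hν
    ext i j
    refine congrFun (not_mulVec_eq_smul hA hν (v := fun i => Z i j) fun i => ?_) i
    exact congrFun (congrFun hZ i) j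
  rcases le_total 0 μ.re with h | h
  · exact hY0 (hcol hAY h)
  · exact hY0 (Matrix.transpose_eq_zero.1 (hcol hYA (by simpa using h)))

lemma gramian_unique {A P P' : Matrix ι ι ℝ} {b : ι → ℝ}
    (hA : ∀ z ∈ spectrum ℂ (ℂ⟦A⟧), z.re < 0)
    (hP : A * P + P * Aᵀ + Matrix.vecMulVec b b = 0)
    (hP' : A * P' + P' * Aᵀ + Matrix.vecMulVec b b = 0) : P = P' := by
  refine sub_eq_zero.1 (eq_zero_of_mul_add_mul_transpose hA ?_)
  calc A * (P - P') + (P - P') * Aᵀ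
      = (A * P + P * Aᵀ + Matrix.vecMulVec b b) - (A * P' + P' * Aᵀ + Matrix.vecMulVec b b) := by
        noncomm_ring
    _ = 0 := by rw [hP, hP', sub_zero]

/-- Gramians transform by congruence under a change of state coordinates. -/
lemma gramian_congr {A A' T P : Matrix ι ι ℝ} {b b' : ι → ℝ} (hT : T * A' = A * T)
    (hb : T *ᵥ b' = b) (hP : A' * P + P * A'ᵀ + Matrix.vecMulVec b' b' = 0) :
    A * (T * P * Tᵀ) + T * P * Tᵀ * Aᵀ + Matrix.vecMulVec b b = 0 := by
  have h1 : T * (A' * P + P * A'ᵀ + Matrix.vecMulVec b' b') * Tᵀ = 0 := by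
    rw [hP, mul_zero, zero_mul]
  have h2 : A'ᵀ * Tᵀ = Tᵀ * Aᵀ := by
    rw [← Matrix.transpose_mul, hT, Matrix.transpose_mul]
  rw [mul_add, mul_add, add_mul, add_mul, Matrix.mul_vecMulVec, Matrix.vecMulVec_mul,
    Matrix.vecMul_transpose, hb, ← mul_assoc, hT, mul_assoc T (P * A'ᵀ), mul_assoc P, h2] at h1
  simpa only [mul_assoc] using h1

lemma spectrum_map_transpose (A : Matrix ι ι ℝ) : spectrum ℂ ℂ⟦Aᵀ⟧ = spectrum ℂ ℂ⟦A⟧ := by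
  ext z
  rw [Matrix.mem_spectrum_iff_isRoot_charpoly, Matrix.mem_spectrum_iff_isRoot_charpoly,
    Matrix.transpose_map, Matrix.charpoly_transpose]

/-- A transformation between two balanced realizations with the same Gramian is orthogonal, and it
is block diagonal with respect to the level sets of the Gramian. -/
lemma balancing_orthogonal {h : ι → ℝ} (hpos : ∀ i, 0 < h i) {T : Matrix ι ι ℝ}
    (h1 : T * Matrix.diagonal h * Tᵀ = Matrix.diagonal h)
    (h2 : Tᵀ * Matrix.diagonal h * T = Matrix.diagonal h) :
    T * Tᵀ = 1 ∧ ∀ i j, T i j ≠ 0 → h i = h j := by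
  -- `Σ² T = (T Σ Tᵀ) Σ T = T Σ (Tᵀ Σ T) = T Σ²`
  have hcomm : Matrix.diagonal h * (Matrix.diagonal h * T)
      = T * Matrix.diagonal h * Matrix.diagonal h := by
    nth_rw 1 [← h1]
    rw [mul_assoc, ← mul_assoc Tᵀ, h2]
  have hlev : ∀ i j, T i j ≠ 0 → h i = h j := by
    intro i j hij
    have := congrFun (congrFun hcomm i) j
    rw [Matrix.mul_diagonal, Matrix.mul_diagonal, Matrix.diagonal_mul, Matrix.diagonal_mul] at this
    have h3 : h i ^ 2 = h j ^ 2 := mul_right_cancel₀ hij (by linear_combination this)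
    exact (sq_eq_sq₀ (hpos i).le (hpos j).le).1 h3
  have hDT : Matrix.diagonal h * T = T * Matrix.diagonal h := by
    ext i j
    rw [Matrix.mul_diagonal, Matrix.diagonal_mul]
    by_cases hij : T i j = 0
    · simp [hij]
    · rw [hlev i j hij, mul_comm]
  refine ⟨mul_eq_one_comm.1 ?_, hlev⟩
  rw [mul_assoc, hDT, ← mul_assoc] at h2
  ext i j
  have := congrFun (congrFun h2 i) j
  rw [Matrix.mul_diagonal] at this
  refine mul_right_cancel₀ (hpos j).ne' (this.trans ?_)
  by_cases hij : i = j
  · rw [hij, Matrix.diagonal_apply_eq, Matrix.one_apply_eq, one_mul]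
  · rw [Matrix.diagonal_apply_ne _ hij, Matrix.one_apply_ne hij, zero_mul]

/-- With `T` the transformation to the sign symmetric realization and `S = diag(s)`, the matrix
`W = T S Tᵀ` symmetrizes the given realization: `A W = W Aᵀ` and `b = W c`. In the discarded
coordinates, where all signs are `ε`, it is `ε` times the identity. -/
lemma exists_symmetrizer {G : SISOSystem ι} {h s : ι → ℝ} (hst : G.AsymptoticallyStable)
    (hbal : G.IsBalanced h) (hpos : ∀ i, 0 < h i) (hs : G.IsSignParameters h s)
    {p : ι → Prop} (hp : ∀ i j, p i → ¬ p j → h i ≠ h j) {ε : ℝ} (hε : ∀ i, ¬ p i → s i = ε) :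
    ∃ W : Matrix ι ι ℝ, Wᵀ = W ∧ G.A * W = W * G.Aᵀ ∧ G.b = W *ᵥ G.c ∧
      ∀ i j, ¬ p i → W i j = if i = j then ε else 0 := by
  obtain ⟨hs1, T, hT, ⟨⟨-, hP⟩, -, hQ⟩, hsA, hsb⟩ := hs
  rw [Matrix.isUnit_iff_isUnit_det] at hT
  set G' := G.changeCoordinates T with hG'
  set S := Matrix.diagonal s with hS
  have hTA : T * G'.A = G.A * T := by
    rw [hG', changeCoordinates, ← mul_assoc, ← mul_assoc, Matrix.mul_nonsing_inv _ hT, one_mul]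
  have hAR : G'.A * T⁻¹ = T⁻¹ * G.A := by
    rw [hG', changeCoordinates, mul_assoc, Matrix.mul_nonsing_inv _ hT, mul_one]
  have hTb : T *ᵥ G'.b = G.b := by
    rw [hG', changeCoordinates, Matrix.mulVec_mulVec, Matrix.mul_nonsing_inv _ hT,
      Matrix.one_mulVec]
  have hcT : G'.c = Tᵀ *ᵥ G.c := by
    rw [hG', changeCoordinates, Matrix.mulVec_transpose]
  have h1 : T * Matrix.diagonal h * Tᵀ = Matrix.diagonal h :=
    gramian_unique hst (gramian_congr hTA hTb hP) hbal.1.2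
  have h2 : Tᵀ * Matrix.diagonal h * T = Matrix.diagonal h := by
    have hR : (T⁻¹)ᵀ * Matrix.diagonal h * (T⁻¹)ᵀᵀ = Matrix.diagonal h := by
      refine gramian_unique (A := G.Aᵀ) (b := G.c) ?_ (gramian_congr (A' := G'.Aᵀ) (b' := G'.c)
        ?_ ?_ ?_) ?_
      · rw [spectrum_map_transpose]
        exact hst
      · rw [← Matrix.transpose_mul, hAR, Matrix.transpose_mul]
      · rw [hcT, Matrix.mulVec_mulVec, ← Matrix.transpose_mul, Matrix.mul_nonsing_inv _ hT,
          Matrix.transpose_one, Matrix.one_mulVec]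
      · rw [Matrix.transpose_transpose]
        exact hQ
      · rw [Matrix.transpose_transpose]
        exact hbal.2.2
    have hTR : Tᵀ * (T⁻¹)ᵀ = 1 := by
      rw [← Matrix.transpose_mul, Matrix.nonsing_inv_mul _ hT, Matrix.transpose_one]
    nth_rw 1 [← hR]
    rw [Matrix.transpose_transpose, mul_assoc, mul_assoc, mul_assoc,
      Matrix.nonsing_inv_mul _ hT, mul_one, ← mul_assoc, hTR, one_mul]
  obtain ⟨horth, hlev⟩ := balancing_orthogonal hpos h1 h2
  have hSS : S * S = 1 := by
    rw [hS, Matrix.diagonal_mul_diagonal, ← Matrix.diagonal_one]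
    congr 1
    ext i
    rcases hs1 i with h | h <;> simp [h]
  refine ⟨T * S * Tᵀ, ?_, ?_, ?_, fun i j hi => ?_⟩
  · rw [Matrix.transpose_mul, Matrix.transpose_mul, Matrix.transpose_transpose,
      hS, Matrix.diagonal_transpose, mul_assoc]
  · calc G.A * (T * S * Tᵀ) = T * G'.A * S * Tᵀ := by rw [hTA]; simp only [mul_assoc]
      _ = T * (S * G'.Aᵀ * S) * S * Tᵀ := by rw [← hsA]
      _ = T * S * G'.Aᵀ * (S * S) * Tᵀ := by simp only [mul_assoc]
      _ = T * S * (T * G'.A)ᵀ := by rw [hSS, mul_one, Matrix.transpose_mul, mul_assoc]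
      _ = T * S * Tᵀ * G.Aᵀ := by rw [hTA, Matrix.transpose_mul, ← mul_assoc]
  · rw [← hTb, hsb, hcT, ← Matrix.mulVec_transpose, Matrix.diagonal_transpose,
      Matrix.mulVec_mulVec, Matrix.mulVec_mulVec]
  · have h3 : ∀ l, T i l * s l = ε * T i l := fun l => by
      by_cases hl : T i l = 0
      · simp [hl]
      · rw [hε l fun hpl => hp l i hpl hi (hlev i l hl).symm, mul_comm]
    have h4 := congrFun (congrFun horth i) j
    rw [Matrix.mul_apply] at h4
    rw [Matrix.mul_apply]
    simp only [hS, Matrix.mul_diagonal, h3, mul_assoc]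
    rw [← Finset.mul_sum, h4, Matrix.one_apply, mul_ite, mul_one, mul_zero]

/-- The error at `s = ∞` is `c₂ A₂₂⁻¹ b₂ = -2 ε tr Σ₂`. -/
lemma d_sub_singularPerturbation_d {G : SISOSystem ι} {h s : ι → ℝ}
    (hst : G.AsymptoticallyStable)
    (hbal : G.IsBalanced h) (hpos : ∀ i, 0 < h i) (hs : G.IsSignParameters h s)
    {p : ι → Prop} [DecidablePred p] (hp : ∀ i j, p i → ¬ p j → h i ≠ h j) {ε : ℝ}
    (hε : ∀ i, ¬ p i → s i = ε) (hε1 : ε * ε = 1) :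
    G.d - (G.singularPerturbation p).d = -(2 * ε * ∑ i : {i // ¬ p i}, h i) := by
  obtain ⟨W, hW, hAW, hbW, hWε⟩ := exists_symmetrizer hst hbal hpos hs hp hε
  have hunit := (Matrix.isUnit_iff_isUnit_det _).1 (isUnit_discardedBlock hbal hst hpos hp)
  have hWε' : ∀ i j, ¬ p i → W j i = if i = j then ε else 0 := fun i j hi => by
    rw [← hWε i j hi, ← Matrix.transpose_apply W, hW]
  have hε0 : ε ≠ 0 := left_ne_zero_of_mul_eq_one hε1
  set A₂₂ := G.discardedBlock p with hA₂₂
  set b₂ : {i // ¬ p i} → ℝ := fun i => G.b i with hb₂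
  set c₂ : {i // ¬ p i} → ℝ := fun i => G.c i with hc₂
  set D : Matrix {i // ¬ p i} {i // ¬ p i} ℝ := Matrix.diagonal fun i => h i with hD
  have hsymm : A₂₂ᵀ = A₂₂ := by
    ext i j
    have h1 := congrFun (congrFun hAW i) j
    simp only [Matrix.mul_apply, hWε _ _ i.2, hWε' _ _ j.2, ite_mul, mul_ite, zero_mul, mul_zero,
      Finset.sum_ite_eq, Finset.mem_univ, if_true, Matrix.transpose_apply] at h1
    exact mul_left_cancel₀ hε0 (h1.symm.trans (mul_comm _ _))
  have hbc : c₂ = ε • b₂ := by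
    ext i
    have h1 := congrFun hbW i
    simp only [Matrix.mulVec, dotProduct, hWε _ _ i.2, ite_mul, zero_mul, Finset.sum_ite_eq,
      Finset.mem_univ, if_true] at h1
    rw [Pi.smul_apply, smul_eq_mul, hb₂, hc₂]
    simp only
    rw [h1, ← mul_assoc, hε1, one_mul]
  have hlyap : Matrix.vecMulVec b₂ b₂ = -(A₂₂ * D + D * A₂₂) := by
    rw [← congrArg (fun M => D * M) hsymm]
    ext i j
    have h1 := congrFun (congrFun hbal.1.2 i) j
    simp only [Matrix.add_apply, Matrix.mul_diagonal, Matrix.diagonal_mul, Matrix.vecMulVec_apply,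
      Matrix.zero_apply] at h1
    simp only [Matrix.neg_apply, Matrix.add_apply, hD, Matrix.mul_diagonal, Matrix.diagonal_mul,
      Matrix.vecMulVec_apply]
    exact eq_neg_of_add_eq_zero_right h1
  calc G.d - (G.singularPerturbation p).d = c₂ ⬝ᵥ (A₂₂⁻¹ *ᵥ b₂) := sub_sub_cancel _ _
    _ = ε * Matrix.trace (A₂₂⁻¹ * Matrix.vecMulVec b₂ b₂) := by
      rw [hbc, smul_dotProduct, smul_eq_mul, Matrix.mul_vecMulVec, Matrix.trace_vecMulVec,
        dotProduct_comm]
    _ = -(2 * ε * Matrix.trace D) := by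
      rw [hlyap, mul_neg, Matrix.trace_neg, mul_add, Matrix.trace_add, ← mul_assoc,
        Matrix.nonsing_inv_mul _ hunit, one_mul, Matrix.trace_mul_comm, mul_assoc,
        Matrix.mul_nonsing_inv _ hunit, mul_one]
      ring
    _ = -(2 * ε * ∑ i : {i // ¬ p i}, h i) := by rw [hD, Matrix.trace_diagonal]

end General

/-! ### Removing the blocks one at a time -/

variable {q : ℕ} {m : Fin q → ℕ} {σ : Fin q → ℝ}

/-- Counting the discarded singular values with multiplicity does not decrease their sum. -/
lemma sum_le_sum_discarded (hm : ∀ j, 0 < m j) (hσpos : ∀ j, 0 < σ j) (k : ℕ) :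
    ∑ j ∈ Finset.univ.filter (fun j : Fin q => k ≤ (j : ℕ)), σ j
      ≤ ∑ i : {i : BlockIndex m // ¬ (i.1 : ℕ) < k}, σ i.1.1 := by
  rw [← Finset.sum_subtype (Finset.univ.filter fun i : BlockIndex m => ¬ (i.1 : ℕ) < k)
    (by simp) fun i => σ i.1, Finset.sum_filter, Finset.sum_filter, Fintype.sum_sigma]
  refine Finset.sum_le_sum fun j _ => ?_
  change _ ≤ ∑ _ : Fin (m j), if ¬ (j : ℕ) < k then σ j else 0
  rw [Finset.sum_const, Finset.card_univ, Fintype.card_fin, nsmul_eq_mul]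
  have h1 : (1 : ℝ) ≤ m j := by exact_mod_cast hm j
  by_cases hj : k ≤ (j : ℕ)
  · rw [if_pos hj, if_pos (not_lt.2 hj)]
    exact le_mul_of_one_le_left (hσpos j).le h1
  · rw [if_neg hj, if_neg (by omega), mul_zero]

variable {G : SISOSystem (BlockIndex m)}

lemma blocks_separated (hσ : StrictAnti σ) (k : ℕ) (i j : BlockIndex m) (hi : (i.1 : ℕ) < k)
    (hj : ¬ (j.1 : ℕ) < k) : σ i.1 ≠ σ j.1 :=
  (hσ (Fin.lt_def.2 (by omega))).ne'

lemma norm_transferFunction_sub_le (hσ : StrictAnti σ) (hσpos : ∀ j, 0 < σ j)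
    (hst : G.AsymptoticallyStable) (hbal : G.IsBalanced fun i => σ i.1) {k : ℕ} (hkq : k ≤ q)
    {s : ℂ} (hs : s.re = 0) :
    ‖G.transferFunction s -
        (G.singularPerturbation fun i => (i.1 : ℕ) < k).transferFunction s‖
      ≤ 2 * ∑ j ∈ Finset.univ.filter (fun j : Fin q => k ≤ (j : ℕ)), σ j := by
  have hpos : ∀ i : BlockIndex m, 0 < σ i.1 := fun i => hσpos i.1
  choose x hx using fun l : ℕ => exists_pencil_solution hbal hst hpos (blocks_separated hσ l) hs.ge
  have hq : ∀ i, (ℂ⟦G.A⟧ *ᵥ x q) i + G.b i = s * x q i := fun i => by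
    rw [hx q i, if_pos i.1.2]
  have htel : ∀ l, k ≤ l → l ≤ q → ‖(fun i => (G.c i : ℂ)) ⬝ᵥ (x l - x k)‖
      ≤ 2 * ∑ j ∈ Finset.univ.filter (fun j : Fin q => k ≤ (j : ℕ) ∧ (j : ℕ) < l), σ j := by
    intro l hl
    induction l, hl using Nat.le_induction with
    | base =>
      intro _
      rw [sub_self, dotProduct_zero, norm_zero]
      exact mul_nonneg two_pos.le (Finset.sum_nonneg fun j _ => (hσpos j).le)
    | succ l hl ih =>
      intro hlq
      have hstep := norm_dotProduct_sub_le hpos hbal.1.2 hbal.2.2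
        (p := fun i : BlockIndex m => (i.1 : ℕ) < l) (p' := fun i => (i.1 : ℕ) < l + 1)
        (fun i hi => Nat.lt_succ_of_lt hi) (hσpos ⟨l, hlq⟩).le
        (fun i h1 h2 => congrArg σ (Fin.ext (by simp only; omega))) hs (hx l) (hx (l + 1))
      have hfil : Finset.univ.filter (fun j : Fin q => k ≤ (j : ℕ) ∧ (j : ℕ) < l + 1)
          = insert ⟨l, hlq⟩ (Finset.univ.filter fun j : Fin q => k ≤ (j : ℕ) ∧ (j : ℕ) < l) := by
        ext j
        simp only [Finset.mem_filter, Finset.mem_univ, true_and, Finset.mem_insert, Fin.ext_iff]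
        omega
      rw [hfil, Finset.sum_insert (by simp), mul_add, ← sub_add_sub_cancel _ (x l) _,
        dotProduct_add]
      exact (norm_add_le _ _).trans (add_le_add hstep (ih (by omega)))
  rw [transferFunction_eq hst hs.ge hq, transferFunction_singularPerturbation_eq hbal hst hpos
    (blocks_separated hσ k) hs.ge (hx k), add_sub_add_right_eq_sub, ← dotProduct_sub]
  simpa using htel q hkq le_rfl

lemma hInfNorm_transferFunction_sub (hm : ∀ j, 0 < m j) (hσ : StrictAnti σ)
    (hσpos : ∀ j, 0 < σ j) (hst : G.AsymptoticallyStable) (hbal : G.IsBalanced fun i => σ i.1)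
    {s : BlockIndex m → ℝ} (hs : G.IsSignParameters (fun i => σ i.1) s) {k : ℕ} (hkq : k ≤ q)
    (hsign : (∀ i : BlockIndex m, k ≤ (i.1 : ℕ) → s i = 1) ∨
      (∀ i : BlockIndex m, k ≤ (i.1 : ℕ) → s i = -1)) :
    hInfNorm (fun z => G.transferFunction z -
        (G.singularPerturbation (fun i => (i.1 : ℕ) < k)).transferFunction z) =
      ENNReal.ofReal (2 * ∑ j ∈ Finset.univ.filter (fun j : Fin q => k ≤ (j : ℕ)), σ j) := by
  refine le_antisymm ?_ ?_
  · refine iSup_le fun ω => ?_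
    rw [← ofReal_norm]
    exact ENNReal.ofReal_le_ofReal
      (norm_transferFunction_sub_le hσ hσpos hst hbal hkq (by simp))
  -- the value at `ω = ∞` is a limit of values on the imaginary axis
  · obtain ⟨ε, hε, hε1⟩ : ∃ ε : ℝ, (∀ i : BlockIndex m, ¬ (i.1 : ℕ) < k → s i = ε) ∧ |ε| = 1 := by
      rcases hsign with h | h
      · exact ⟨1, fun i hi => h i (not_lt.1 hi), by simp⟩
      · exact ⟨-1, fun i hi => h i (not_lt.1 hi), by simp⟩
    have hpos : ∀ i : BlockIndex m, 0 < σ i.1 := fun i => hσpos i.1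
    have hd := d_sub_singularPerturbation_d hst hbal hpos hs
      (blocks_separated hσ k) hε
      (by rw [← abs_mul_abs_self, hε1, one_mul])
    have hlim := ((tendsto_transferFunction G).sub (tendsto_transferFunction
      (G.singularPerturbation fun i => (i.1 : ℕ) < k))).enorm
    refine le_trans ?_ (le_of_tendsto' hlim fun ω => le_iSup (fun ω : ℝ =>
      ‖G.transferFunction (Complex.I * ω) - (G.singularPerturbation fun i =>
        (i.1 : ℕ) < k).transferFunction (Complex.I * ω)‖ₑ) ω)
    rw [← ofReal_norm, ← Complex.ofReal_sub, Complex.norm_real, hd, Real.norm_eq_abs,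
      abs_neg, abs_mul, abs_mul, hε1, abs_two, mul_one]
    refine ENNReal.ofReal_le_ofReal (mul_le_mul_of_nonneg_left ?_ two_pos.le)
    exact (sum_le_sum_discarded hm hσpos k).trans (le_abs_self _)

end SISOSystem

theorem theorem3p2
    -- the distinct Hankel singular values `σ` with multiplicities `m`
    (q : ℕ) (m : Fin q → ℕ) (hm : ∀ j, 0 < m j)
    (σ : Fin q → ℝ) (hσ : StrictAnti σ) (hσpos : ∀ j, 0 < σ j)
    -- a balanced system with Gramian `diag(σ_1 I_{m_1}, …, σ_q I_{m_q})`
    (G : SISOSystem (BlockIndex m))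
    (hstable : G.AsymptoticallyStable) (hmin : G.Minimal)
    (hbal : G.IsBalanced (fun i => σ i.1))
    -- its sign parameters
    (s : BlockIndex m → ℝ) (hs : G.IsSignParameters (fun i => σ i.1) s)
    -- the first `k` blocks are retained; the signs of the other blocks agree
    (k : ℕ) (hk : 1 ≤ k) (hkq : k < q)
    (hsign : (∀ i : BlockIndex m, k ≤ (i.1 : ℕ) → s i = 1) ∨
      (∀ i : BlockIndex m, k ≤ (i.1 : ℕ) → s i = -1)) :
    -- the approximation is well defined, asymptotically stable, and attains the error bound
    IsUnit (G.discardedBlock (fun i => (i.1 : ℕ) < k)) ∧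
    (G.singularPerturbation (fun i => (i.1 : ℕ) < k)).AsymptoticallyStable ∧
    hInfNorm (fun z => G.transferFunction z -
        (G.singularPerturbation (fun i => (i.1 : ℕ) < k)).transferFunction z) =
      ENNReal.ofReal (2 * ∑ j ∈ Finset.univ.filter (fun j : Fin q => k ≤ (j : ℕ)), σ j) := by
  have hpos : ∀ i : BlockIndex m, 0 < σ i.1 := fun i => hσpos i.1
  have hp := SISOSystem.blocks_separated (m := m) hσ k
  exact ⟨SISOSystem.isUnit_discardedBlock hbal hstable hpos hp,
    SISOSystem.asymptoticallyStable_singularPerturbation hbal hstable hpos hp,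
    SISOSystem.hInfNorm_transferFunction_sub hm hσ hσpos hstable hbal hs hkq.le hsign⟩
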